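/- Let $A,C\in\mathbb R^{n\times n}$, $B,D\in\mathbb R^{n\times m_1}$, $G\in\mathbb R^{n\times m_2}$, $0\le Q\in\mathbb R^{n\times n}$, $0<R\in\mathbb R^{m_1\times m_1}$ (symmetric) and $\gamma>0$. For $K\in\mathbb R^{m_1\times n}$, $L\in\mathbb R^{m_2\times n}$ and symmetric $P$ put $$\mathscr L_{[K,L]}(P)=(A-BK+GL)^\top P+P(A-BK+GL)+(C-DK)^\top P(C-DK),$$ $$\mathscr K^1(P)=(R+D^\top PD)^{-1}(B^\top P+D^\top PC),\qquad \mathscr K^2(P)=\gamma^{-2}G^\top P,$$ and let $\sigma(\mathscr L_{[K,L]})\subset\mathbb C$ be the spectrum of $\mathscr L_{[K,L]}$ on the (complex) symmetric matrices. Let $\mathcal Z(L)=\{K:\sigma(\mathscr L_{[K,L]})\subset\mathbb C^-\}$, where $\mathbb C^-$ is the open left half-plane. A symmetric matrix $P$ is called the stabilizing solution for $L$, written $P_L$, if $R+D^\top PD>0$ (which is automatic when $P\ge 0$), $K=\mathscr K^1(P)$ satisfies $K\in\mathcal Z(L)$, and $\mathscr L_{[K,L]}(P)+Q-\gamma^2L^\top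 L+K^\top RK=0$. For $K\in\mathcal Z(L)$ let $P_K$ be the symmetric solution of $\mathscr L_{[K,L]}(P_K)+Q-\gamma^2L^\top L+K^\top RK=0$, and for $\rho>0$ let $\mathcal G_\rho(L)=\{K\in\mathcal Z(L):\mathrm{Tr}(P_K-P_L)\le\rho\}$. Let $\{\hat P^k,\hat L_p^k\}$ be generated by the inexact outer loop with disturbances $\delta L_p^k\in\mathbb R^{m_2\times n}$: $\hat L_p^0=0$ and, for $k\ge1$, $\hat P^k$ is the stabilizing solution for $\hat L_p^{k-1}$ and $\hat L_p^k=\mathscr K^2(\hat P^k)+\delta L_p^k$. **Theorem.** Fix any outer-loop index $k\ge1$ and any $\rho>0$. There exist $\tilde\varepsilon>0$, a $\mathcal{KL}$-function $\tilde\ell$ and a $\mathcal K$-function $\tilde\kappa$ such that, for every initial gain $\hat K_p^{(k,0)}\in\mathcal G_\rho(\hat L_p^{k-1})$ and every disturbance sequence $\delta K_p^k=\{\delta K_p^{(k,j)}\}_{j\ge1}$ in $\mathbb R^{m_1\times n}$ with $\|\delta K_p^k\|_\infty:=\sup_{j\ge1}\|\delta K_p^{(k,j)}\|_F<\tilde\varepsilon$,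 the inexact inner loop $$\mathscr L_{[\hat K_p^{(k,j-1)},\hat L_p^{k-1}]}(\hat P^{(k,j)})+Q-\gamma^2(\hat L_p^{k-1})^\top\hat L_p^{k-1}+(\hat K_p^{(k,j-1)})^\top R\,\hat K_p^{(k,j-1)}=0,\qquad \hat K_p^{(k,j)}=\mathscr K^1(\hat P^{(k,j)})+\delta K_p^{(k,j)},\qquad j\ge1,$$ has a solution with all $\hat P^{(k,j)}$ symmetric, and every such solution satisfies, for all $j\ge1$, $$\|\hat P^{(k,j)}-\hat P^k\|_F\le\tilde\ell\big(\|\hat P^{(k,1)}-\hat P^k\|_F,\,j\big)+\tilde\kappa\big(\|\delta K_p^k\|_\infty\big).$$ That is, the inner loop is small-disturbance input-to-state stable. -/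

import Mathlib

open scoped Matrix NNReal ENNReal Matrix.Norms.Frobenius
open Filter Topology

/-- The data of the stochastic linear quadratic problem
`dx = (A x + B u + G v) dt + (C x + D u) dw` with weights `Q ≥ 0`, `R > 0` and
attenuation level `γ > 0`. -/
structure LQSystem (n m₁ m₂ : ℕ) where
  A : Matrix (Fin n) (Fin n) ℝ
  B : Matrix (Fin n) (Fin m₁) ℝ
  G : Matrix (Fin n) (Fin m₂) ℝ
  C : Matrix (Fin n) (Fin n) ℝ
  D : Matrix (Fin n) (Fin m₁) ℝ
  Q : Matrix (Fin n) (Fin n) ℝ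
  R : Matrix (Fin m₁) (Fin m₁) ℝ
  γ : ℝ
  Q_posSemidef : Q.PosSemidef
  R_posDef : R.PosDef
  γ_pos : 0 < γ

namespace LQSystem

variable {n m₁ m₂ : ℕ} (S : LQSystem n m₁ m₂)

/-- Closed-loop drift matrix `A - B K + G L`. -/
def drift (K : Matrix (Fin m₁) (Fin n) ℝ) (L : Matrix (Fin m₂) (Fin n) ℝ) :
    Matrix (Fin n) (Fin n) ℝ :=
  S.A - S.B * K + S.G * L

/-- Closed-loop diffusion matrix `C - D K`. -/
def diffusion (K : Matrix (Fin m₁) (Fin n) ℝ) : Matrix (Fin n) (Fin n) ℝ :=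
  S.C - S.D * K

/-- The generalized Lyapunov operator
`P ↦ (A - B K + G L)ᵀ P + P (A - B K + G L) + (C - D K)ᵀ P (C - D K)`. -/
def lyap (K : Matrix (Fin m₁) (Fin n) ℝ) (L : Matrix (Fin m₂) (Fin n) ℝ)
    (P : Matrix (Fin n) (Fin n) ℝ) : Matrix (Fin n) (Fin n) ℝ :=
  (S.drift K L)ᵀ * P + P * S.drift K L + (S.diffusion K)ᵀ * P * S.diffusion K

/-- The spectrum of the generalized Lyapunov operator on symmetric matrices: the complex `μ`
for which the operator, extended to complex symmetric matrices, has an eigenmatrix `X ≠ 0`. -/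
def lyapSpectrum (K : Matrix (Fin m₁) (Fin n) ℝ) (L : Matrix (Fin m₂) (Fin n) ℝ) : Set ℂ :=
  {μ | ∃ X : Matrix (Fin n) (Fin n) ℂ, X.IsSymm ∧ X ≠ 0 ∧
    ((S.drift K L).map Complex.ofReal)ᵀ * X + X * (S.drift K L).map Complex.ofReal
      + ((S.diffusion K).map Complex.ofReal)ᵀ * X * (S.diffusion K).map Complex.ofReal
      = μ • X}

/-- `K ∈ 𝒵(L)`: the spectrum of the generalized Lyapunov operator lies in the open left
half-plane. -/
def admissibleGains (L : Matrix (Fin m₂) (Fin n) ℝ) : Set (Matrix (Fin m₁) (Fin n) ℝ) :=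
  {K | S.lyapSpectrum K L ⊆ {μ : ℂ | μ.re < 0}}

/-- The gain mapping `P ↦ (R + Dᵀ P D)⁻¹ (Bᵀ P + Dᵀ P C)`. -/
noncomputable def gainK (P : Matrix (Fin n) (Fin n) ℝ) : Matrix (Fin m₁) (Fin n) ℝ :=
  (S.R + S.Dᵀ * P * S.D)⁻¹ * (S.Bᵀ * P + S.Dᵀ * P * S.C)

/-- The gain mapping `P ↦ γ⁻² Gᵀ P`. -/
noncomputable def gainL (P : Matrix (Fin n) (Fin n) ℝ) : Matrix (Fin m₂) (Fin n) ℝ :=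
  (1 / S.γ ^ 2) • (S.Gᵀ * P)

/-- `P` is a (symmetric) solution of the Lyapunov-type equation with the gains `K`, `L` fixed:
`𝓛_[K,L](P) + Q - γ² Lᵀ L + Kᵀ R K = 0`. -/
def IsLyapSolution (K : Matrix (Fin m₁) (Fin n) ℝ) (L : Matrix (Fin m₂) (Fin n) ℝ)
    (P : Matrix (Fin n) (Fin n) ℝ) : Prop :=
  P.IsSymm ∧ S.lyap K L P + (S.Q - S.γ ^ 2 • (Lᵀ * L)) + Kᵀ * S.R * K = 0

/-- `P` is the stabilizing solution of the stochastic algebraic Riccati equation with the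
disturbance gain `L` fixed: it solves `𝓛_[K,L](P) + Q - γ² Lᵀ L + Kᵀ R K = 0` for
`K = (R + Dᵀ P D)⁻¹ (Bᵀ P + Dᵀ P C)`, where `R + Dᵀ P D > 0` (which always holds if `P ≥ 0`),
and this `K` is stabilizing. -/
structure IsStabilizingSolution (L : Matrix (Fin m₂) (Fin n) ℝ)
    (P : Matrix (Fin n) (Fin n) ℝ) : Prop where
  posDef : (S.R + S.Dᵀ * P * S.D).PosDef
  solution : S.IsLyapSolution (S.gainK P) L P
  stabilizing : S.gainK P ∈ S.admissibleGains L

/-- The set `𝒢_ρ(L)` of the `K ∈ 𝒵(L)` with `Tr (P_K - P_L) ≤ ρ`, where `P_K` solves the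
Lyapunov-type equation for `K`, `L`, and `PL` is the stabilizing solution `P_L` belonging
to `L`. -/
def gainSublevel (L : Matrix (Fin m₂) (Fin n) ℝ) (PL : Matrix (Fin n) (Fin n) ℝ) (ρ : ℝ) :
    Set (Matrix (Fin m₁) (Fin n) ℝ) :=
  {K | K ∈ S.admissibleGains L ∧
    ∃ PK : Matrix (Fin n) (Fin n) ℝ, S.IsLyapSolution K L PK ∧ (PK - PL).trace ≤ ρ}

/-- The inexact outer loop with disturbances `δL 1, δL 2, …`: `Lhat 0 = 0`, the matrix
`Phat (k + 1)` is the stabilizing solution belonging to `Lhat k`, and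
`Lhat k = γ⁻² Gᵀ (Phat k) + δL k` for `k ≥ 1`. The values `Phat 0` and `δL 0` are not used. -/
structure IsInexactOuterLoop (δL Lhat : ℕ → Matrix (Fin m₂) (Fin n) ℝ)
    (Phat : ℕ → Matrix (Fin n) (Fin n) ℝ) : Prop where
  init : Lhat 0 = 0
  solve : ∀ k, S.IsStabilizingSolution (Lhat k) (Phat (k + 1))
  update : ∀ k, 1 ≤ k → Lhat k = S.gainL (Phat k) + δL k

/-- The inexact inner loop for the fixed disturbance gain `L`, with initial gain `K₀` and
disturbances `δK 1, δK 2, …`: `Khat 0 = K₀`, the matrix `Phat (j + 1)` solves the Lyapunov-type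
equation for `Khat j`, and `Khat j = (R + Dᵀ P D)⁻¹ (Bᵀ P + Dᵀ P C) + δK j` with `P = Phat j`
for `j ≥ 1`. The values `Phat 0` and `δK 0` are not used. -/
structure IsInexactInnerLoop (L : Matrix (Fin m₂) (Fin n) ℝ) (K₀ : Matrix (Fin m₁) (Fin n) ℝ)
    (δK Khat : ℕ → Matrix (Fin m₁) (Fin n) ℝ)
    (Phat : ℕ → Matrix (Fin n) (Fin n) ℝ) : Prop where
  init : Khat 0 = K₀
  solve : ∀ j, S.IsLyapSolution (Khat j) L (Phat (j + 1))
  update : ∀ j, 1 ≤ j → Khat j = S.gainK (Phat j) + δK j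

end LQSystem

/-- Class `𝒦` functions on `[0, ∞)`. -/
def IsClassK (κ : ℝ≥0 → ℝ≥0) : Prop :=
  Continuous κ ∧ StrictMono κ ∧ κ 0 = 0

/-- Class `𝒦ℒ` functions on `[0, ∞) × [0, ∞)`. -/
def IsClassKL (ℓ : ℝ≥0 → ℝ≥0 → ℝ≥0) : Prop :=
  Continuous (fun p : ℝ≥0 × ℝ≥0 => ℓ p.1 p.2) ∧
  (∀ t, IsClassK (fun s => ℓ s t)) ∧
  ∀ s, Antitone (ℓ s) ∧ Tendsto (ℓ s) atTop (𝓝 0)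

/-- The supremum over `j ≥ 1` of the Frobenius norms of the matrices `δ j`, in `[0, ∞]`. -/
noncomputable def supFrobenius {m n : ℕ} (δ : ℕ → Matrix (Fin m) (Fin n) ℝ) : ℝ≥0∞ :=
  ⨆ j : ℕ, ‖δ (j + 1)‖ₑ

/-! Write `Pst` for the stabilizing solution and X = P - Pst for the error. Completing the square in
the gain (`residual_eq`) gives X ≥ 0 for every stabilizing K. Hence Tr X, which is linear and
comparable to the norm of X, can serve as the Lyapunov function of the iteration.

With K' = 𝒦¹(P) + δ and P' its solution, the same identity gives 𝓛_{K'}(P' - P) = F - δᵀWδ, where W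
= R + DᵀPD and F = (K - 𝒦¹(P))ᵀ W (K - 𝒦¹(P)) is the defect of K. The defect forces decrease: if
𝓛_{K'}(Z) = -F, then Tr Z is at least a fixed fraction of Tr X, since F controls X
(`trace_sub_le_norm_defect`) and the gains 𝒦¹(P) are bounded on the sublevel set
(`exists_norm_gainK_sub_le`). The disturbance term is absorbed by a certificate V + aX
(`exists_uniform_certificate`). Together, Tr X' ≤ θ Tr X + c‖δ‖² with θ < 1
(`exists_step_constants`). Small disturbances therefore leave the sublevel set invariant, and
summing a geometric series gives the estimate.

Stability is used as the existence of V > 0 with 𝓛(V) < 0, extracted from the spectrum by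
`isLyapStable_of_eigenvalues`. It yields the comparison principle `IsLyapStable.posSemidef` and
solvability, so the later iterates need no spectral information. -/

namespace Matrix

variable {m n : ℕ}

/-! ### Quadratic forms, Frobenius norm and trace. -/

section RealQuadraticForms

lemma posSemidef_real_iff {M : Matrix (Fin n) (Fin n) ℝ} :
    M.PosSemidef ↔ M.IsSymm ∧ ∀ v : Fin n → ℝ, 0 ≤ v ⬝ᵥ M *ᵥ v := by
  rw [posSemidef_iff_dotProduct_mulVec]
  simp [IsHermitian, IsSymm, conjTranspose_eq_transpose_of_trivial]

lemma posDef_real_iff {M : Matrix (Fin n) (Fin n) ℝ} :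
    M.PosDef ↔ M.IsSymm ∧ ∀ v : Fin n → ℝ, v ≠ 0 → 0 < v ⬝ᵥ M *ᵥ v := by
  rw [posDef_iff_dotProduct_mulVec]
  simp [IsHermitian, IsSymm, conjTranspose_eq_transpose_of_trivial]

lemma dotProduct_self_pos' {v : Fin n → ℝ} (hv : v ≠ 0) : 0 < v ⬝ᵥ v := by
  simpa using dotProduct_star_self_pos_iff.2 hv

lemma dotProduct_self_nonneg' (v : Fin n → ℝ) : 0 ≤ v ⬝ᵥ v := by
  simpa using dotProduct_star_self_nonneg v

lemma dotProduct_self_eq_norm_sq (v : Fin n → ℝ) : v ⬝ᵥ v = ‖WithLp.toLp 2 v‖ ^ 2 := by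
  rw [EuclideanSpace.norm_sq_eq]
  simp [dotProduct, sq]

lemma norm_toLp_mulVec_le (M : Matrix (Fin m) (Fin n) ℝ) (v : Fin n → ℝ) :
    ‖WithLp.toLp 2 (M *ᵥ v)‖ ≤ ‖M‖ * ‖WithLp.toLp 2 v‖ := by
  have h := frobenius_norm_mul M (replicateCol Unit v)
  rwa [← replicateCol_mulVec, frobenius_norm_replicateCol, frobenius_norm_replicateCol] at h

lemma mulVec_dotProduct_mulVec_le (M : Matrix (Fin m) (Fin n) ℝ) (v : Fin n → ℝ) :
    (M *ᵥ v) ⬝ᵥ (M *ᵥ v) ≤ ‖M‖ ^ 2 * (v ⬝ᵥ v) := by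
  rw [dotProduct_self_eq_norm_sq, dotProduct_self_eq_norm_sq, ← mul_pow]
  gcongr
  exact norm_toLp_mulVec_le M v

lemma abs_dotProduct_le_norm (v w : Fin n → ℝ) :
    |v ⬝ᵥ w| ≤ ‖WithLp.toLp 2 v‖ * ‖WithLp.toLp 2 w‖ := by
  have := abs_real_inner_le_norm (WithLp.toLp 2 w) (WithLp.toLp 2 v)
  rw [EuclideanSpace.inner_toLp_toLp] at this
  simpa [mul_comm] using this

lemma abs_dotProduct_mulVec_le (M : Matrix (Fin n) (Fin n) ℝ) (v : Fin n → ℝ) :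
    |v ⬝ᵥ M *ᵥ v| ≤ ‖M‖ * (v ⬝ᵥ v) := by
  refine (abs_dotProduct_le_norm v (M *ᵥ v)).trans ?_
  have h := norm_toLp_mulVec_le M v
  rw [dotProduct_self_eq_norm_sq]
  nlinarith [norm_nonneg (WithLp.toLp 2 v)]

lemma posSemidef_conj {a b : ℕ} {W : Matrix (Fin a) (Fin a) ℝ} (hW : W.PosSemidef)
    (E : Matrix (Fin a) (Fin b) ℝ) : (Eᵀ * W * E).PosSemidef := by
  simpa [conjTranspose_eq_transpose_of_trivial] using hW.conjTranspose_mul_mul_same E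

lemma dotProduct_conj_mulVec {a b : ℕ} (W : Matrix (Fin a) (Fin a) ℝ) (E : Matrix (Fin a) (Fin b) ℝ)
    (v : Fin b → ℝ) : v ⬝ᵥ (Eᵀ * W * E) *ᵥ v = (E *ᵥ v) ⬝ᵥ W *ᵥ (E *ᵥ v) := by
  rw [Matrix.mul_assoc, ← mulVec_mulVec, dotProduct_transpose_mulVec, dotProduct_comm,
    ← mulVec_mulVec]

lemma dotProduct_conj_mulVec_le {a b : ℕ} (W : Matrix (Fin a) (Fin a) ℝ)
    (E : Matrix (Fin a) (Fin b) ℝ) (v : Fin b → ℝ) :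
    v ⬝ᵥ (Eᵀ * W * E) *ᵥ v ≤ ‖W‖ * ‖E‖ ^ 2 * (v ⬝ᵥ v) := by
  rw [dotProduct_conj_mulVec]
  refine (le_of_abs_le (abs_dotProduct_mulVec_le W (E *ᵥ v))).trans ?_
  rw [mul_assoc]
  gcongr
  exact mulVec_dotProduct_mulVec_le E v

lemma norm_sq_eq_trace (C : Matrix (Fin m) (Fin n) ℝ) : ‖C‖ ^ 2 = (Cᵀ * C).trace := by
  rw [frobenius_norm_def, ← Real.rpow_natCast, ← Real.rpow_mul (by positivity)]
  simp only [one_div, Nat.cast_ofNat, ne_eq, OfNat.ofNat_ne_zero, not_false_eq_true,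
    inv_mul_cancel₀, Real.rpow_one, trace, diag_apply, mul_apply, transpose_apply]
  rw [Finset.sum_comm]
  simp [sq]

/-- Factor Z = CᵀC: then Tr Z = ‖C‖², while ‖Z‖ ≤ ‖Cᵀ‖‖C‖. -/
lemma PosSemidef.norm_le_trace {Z : Matrix (Fin n) (Fin n) ℝ} (hZ : Z.PosSemidef) :
    ‖Z‖ ≤ Z.trace := by
  obtain ⟨C, rfl⟩ : ∃ C : Matrix (Fin n) (Fin n) ℝ, Z = Cᵀ * C := by
    open scoped MatrixOrder in
    obtain ⟨C, hC⟩ := CStarAlgebra.nonneg_iff_eq_star_mul_self.1 hZ.nonneg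
    exact ⟨C, hC⟩
  rw [← norm_sq_eq_trace, sq]
  simpa using frobenius_norm_mul Cᵀ C

lemma abs_apply_le_norm (M : Matrix (Fin m) (Fin n) ℝ) (i : Fin m) (j : Fin n) :
    |M i j| ≤ ‖M‖ := by
  refine abs_le_of_sq_le_sq ?_ (norm_nonneg _)
  rw [norm_sq_eq_trace]
  simp only [trace, diag_apply, mul_apply, transpose_apply]
  calc M i j ^ 2 = M i j * M i j := sq _
    _ ≤ ∑ x, M x j * M x j :=
      Finset.single_le_sum (f := fun x => M x j * M x j) (fun x _ => mul_self_nonneg _)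
        (Finset.mem_univ i)
    _ ≤ _ := Finset.single_le_sum (f := fun y => ∑ x, M x y * M x y)
        (fun y _ => Finset.sum_nonneg fun x _ => mul_self_nonneg _) (Finset.mem_univ j)

lemma trace_le_card_mul_norm (M : Matrix (Fin n) (Fin n) ℝ) : M.trace ≤ n * ‖M‖ := by
  calc M.trace ≤ ∑ _i : Fin n, ‖M‖ :=
        Finset.sum_le_sum fun i _ => (le_abs_self _).trans (abs_apply_le_norm M i i)
    _ = n * ‖M‖ := by simp

/-- The generalized Rayleigh quotient `x ↦ (xᵀ M x) / (xᵀ V x)` attains its minimum. -/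
lemma exists_rayleigh_min (M : Matrix (Fin n) (Fin n) ℝ) {V : Matrix (Fin n) (Fin n) ℝ}
    (hV : V.PosDef) {u : Fin n → ℝ} (hu : u ≠ 0) :
    ∃ v : Fin n → ℝ, v ≠ 0 ∧
      ∀ x, (v ⬝ᵥ M *ᵥ v) * (x ⬝ᵥ V *ᵥ x) ≤ (x ⬝ᵥ M *ᵥ x) * (v ⬝ᵥ V *ᵥ v) := by
  have hVpos := (posDef_real_iff.1 hV).2
  have hne : (Metric.sphere (0 : Fin n → ℝ) 1).Nonempty :=
    ⟨‖u‖⁻¹ • u, by simp [norm_smul, hu]⟩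
  have hns : ∀ x ∈ Metric.sphere (0 : Fin n → ℝ) 1, x ≠ 0 := by
    rintro x hx rfl
    simp at hx
  have hcont : ∀ N : Matrix (Fin n) (Fin n) ℝ, Continuous fun x : Fin n → ℝ => x ⬝ᵥ N *ᵥ x := by
    intro N
    fun_prop
  obtain ⟨v, hv, hmin⟩ := (isCompact_sphere (0 : Fin n → ℝ) 1).exists_isMinOn hne
    (f := fun x => (x ⬝ᵥ M *ᵥ x) / (x ⬝ᵥ V *ᵥ x))
    ((hcont M).continuousOn.div (hcont V).continuousOn fun x hx => (hVpos x (hns x hx)).ne')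
  refine ⟨v, hns v hv, fun x => ?_⟩
  by_cases hx : x = 0
  · simp [hx]
  have hxs : ‖x‖⁻¹ • x ∈ Metric.sphere (0 : Fin n → ℝ) 1 := by simp [norm_smul, hx]
  have h := hmin hxs
  simp only [Set.mem_ofPred_eq] at h
  rw [div_le_div_iff₀ (hVpos v (hns v hv)) (hVpos _ (hns _ hxs))] at h
  simp only [mulVec_smul, dotProduct_smul, smul_dotProduct, smul_eq_mul] at h
  have hp : 0 < ‖x‖⁻¹ * ‖x‖⁻¹ := by
    have := norm_pos_iff.2 hx
    positivity
  refine le_of_mul_le_mul_left ?_ hp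
  linarith

lemma PosDef.exists_pos_mul_le {V : Matrix (Fin n) (Fin n) ℝ} (hV : V.PosDef) :
    ∃ w : ℝ, 0 < w ∧ ∀ v : Fin n → ℝ, w * (v ⬝ᵥ v) ≤ v ⬝ᵥ V *ᵥ v := by
  by_cases h : ∃ u : Fin n → ℝ, u ≠ 0
  · obtain ⟨u, hu⟩ := h
    obtain ⟨v, hv, hmin⟩ := exists_rayleigh_min V PosDef.one hu
    refine ⟨(v ⬝ᵥ V *ᵥ v) / (v ⬝ᵥ v),
      div_pos ((posDef_real_iff.1 hV).2 v hv) (dotProduct_self_pos' hv), fun x => ?_⟩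
    have := hmin x
    simp only [one_mulVec] at this
    rwa [div_mul_eq_mul_div, div_le_iff₀ (dotProduct_self_pos' hv)]
  · push Not at h
    exact ⟨1, one_pos, fun v => by simp [h v]⟩

end RealQuadraticForms

/-! ### Comparison principle, solvability and certificates for X ↦ AᵀX + XA + CᵀXC. -/

section GeneralizedLyapunov

/-- The generalized Lyapunov operator `X ↦ Aᵀ X + X A + Cᵀ X C`. -/
def genLyap (A C X : Matrix (Fin n) (Fin n) ℝ) : Matrix (Fin n) (Fin n) ℝ :=
  Aᵀ * X + X * A + Cᵀ * X * C

variable {A C X Y V H : Matrix (Fin n) (Fin n) ℝ}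

lemma genLyap_add : genLyap A C (X + Y) = genLyap A C X + genLyap A C Y := by
  simp only [genLyap, mul_add, add_mul]
  abel

lemma genLyap_smul (a : ℝ) : genLyap A C (a • X) = a • genLyap A C X := by
  simp only [genLyap, mul_smul_comm, smul_mul_assoc, smul_add]

lemma genLyap_neg : genLyap A C (-X) = -genLyap A C X := by
  simpa using genLyap_smul (A := A) (C := C) (X := X) (-1)

lemma genLyap_sub : genLyap A C (X - Y) = genLyap A C X - genLyap A C Y := by
  rw [sub_eq_add_neg, genLyap_add, genLyap_neg, ← sub_eq_add_neg]

lemma genLyap_transpose : (genLyap A C X)ᵀ = genLyap A C Xᵀ := by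
  simp only [genLyap, transpose_add, transpose_mul, transpose_transpose, Matrix.mul_assoc]
  abel

lemma IsSymm.genLyap (hX : X.IsSymm) : (genLyap A C X).IsSymm := by
  rw [IsSymm, genLyap_transpose, hX.eq]

lemma genLyap_shift (s : ℝ) :
    genLyap (A - (s / 2) • 1) C X = genLyap A C X - s • X := by
  simp only [genLyap, transpose_sub, transpose_smul, transpose_one, sub_mul, mul_sub,
    smul_mul_assoc, mul_smul_comm, one_mul, mul_one]
  have : s • X = (s / 2) • X + (s / 2) • X := by rw [← add_smul, add_halves]
  rw [this]
  abel

lemma norm_genLyap_le : ‖genLyap A C X‖ ≤ (2 * ‖A‖ + ‖C‖ ^ 2) * ‖X‖ := by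
  have h1 := frobenius_norm_mul Aᵀ X
  have h2 := frobenius_norm_mul X A
  have h3 := frobenius_norm_mul (Cᵀ * X) C
  have h4 := frobenius_norm_mul Cᵀ X
  rw [frobenius_norm_transpose] at h1 h4
  have h5 : ‖Cᵀ * X‖ * ‖C‖ ≤ ‖C‖ * ‖X‖ * ‖C‖ := by gcongr
  calc ‖genLyap A C X‖ ≤ ‖Aᵀ * X‖ + ‖X * A‖ + ‖Cᵀ * X * C‖ := norm_add₃_le
    _ ≤ _ := by linarith

lemma dotProduct_genLyap (hX : X.IsSymm) (v : Fin n → ℝ) :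
    v ⬝ᵥ genLyap A C X *ᵥ v = 2 * ((A *ᵥ v) ⬝ᵥ X *ᵥ v) + (C *ᵥ v) ⬝ᵥ X *ᵥ (C *ᵥ v) := by
  have h : v ⬝ᵥ X *ᵥ (A *ᵥ v) = (A *ᵥ v) ⬝ᵥ X *ᵥ v := by
    conv_lhs => rw [← hX.eq, dotProduct_transpose_mulVec]
  simp only [genLyap, add_mulVec, dotProduct_add, ← mulVec_mulVec, dotProduct_transpose_mulVec, h]
  rw [dotProduct_comm (X *ᵥ v), dotProduct_comm (X *ᵥ (C *ᵥ v))]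
  ring

/-- A matrix in the kernel of a positive semidefinite `X` makes the generalized Lyapunov form
of `X` nonnegative. -/
lemma PosSemidef.dotProduct_genLyap_nonneg (hX : X.PosSemidef) {v : Fin n → ℝ}
    (hv : v ⬝ᵥ X *ᵥ v = 0) : 0 ≤ v ⬝ᵥ genLyap A C X *ᵥ v := by
  have h0 : X *ᵥ v = 0 := by
    refine (hX.dotProduct_mulVec_zero_iff v).1 ?_
    simpa using hv
  rw [dotProduct_genLyap (posSemidef_real_iff.1 hX).1, h0]
  simpa using (posSemidef_real_iff.1 hX).2 (C *ᵥ v)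

/-- Mean-square stability of `dx = A x dt + C x dw`, in terms of a Lyapunov certificate. -/
def IsLyapStable (A C : Matrix (Fin n) (Fin n) ℝ) : Prop :=
  ∃ V : Matrix (Fin n) (Fin n) ℝ, V.PosDef ∧ (-(genLyap A C V)).PosDef

/-- Comparison principle by first contact. If Y were not positive semidefinite, the least t with Y +
tV ≥ 0 would be positive, and Y + tV would annihilate some v ≠ 0. There its Lyapunov form is
nonnegative, whereas the hypotheses on Y and V make it negative. -/
lemma IsLyapStable.posSemidef (h : IsLyapStable A C) (hY : Y.IsSymm)
    (hTY : (-(genLyap A C Y)).PosSemidef) : Y.PosSemidef := by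
  obtain ⟨V, hV, hTV⟩ := h
  rw [posSemidef_real_iff]
  refine ⟨hY, ?_⟩
  by_contra! hneg
  obtain ⟨u, hu⟩ := hneg
  have hu0 : u ≠ 0 := by
    rintro rfl
    simp at hu
  obtain ⟨v, hv, hmin⟩ := exists_rayleigh_min Y hV hu0
  have hVpos := (posDef_real_iff.1 hV).2
  set t : ℝ := -(v ⬝ᵥ Y *ᵥ v) / (v ⬝ᵥ V *ᵥ v) with ht
  have htv : t * (v ⬝ᵥ V *ᵥ v) = -(v ⬝ᵥ Y *ᵥ v) := by
    rw [ht, div_mul_cancel₀ _ (hVpos v hv).ne']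
  have htpos : 0 < t := by
    have h1 := hmin u
    have h2 := hVpos u hu0
    have h3 := hVpos v hv
    have h4 : v ⬝ᵥ Y *ᵥ v < 0 := by
      by_contra! hc
      nlinarith [mul_nonneg hc h2.le, mul_neg_of_neg_of_pos hu h3]
    exact div_pos (by linarith) h3
  have hq : ∀ x : Fin n → ℝ, x ⬝ᵥ (Y + t • V) *ᵥ x = x ⬝ᵥ Y *ᵥ x + t * (x ⬝ᵥ V *ᵥ x) := by
    intro x
    simp [add_mulVec, smul_mulVec, dotProduct_add]
  have hpsd : (Y + t • V).PosSemidef := by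
    rw [posSemidef_real_iff]
    refine ⟨hY.add ((posDef_real_iff.1 hV).1.smul t), fun x => ?_⟩
    rw [hq]
    have h3 := hVpos v hv
    refine nonneg_of_mul_nonneg_left ?_ h3
    linarith [hmin x, congrArg (· * (x ⬝ᵥ V *ᵥ x)) htv]
  have hge := hpsd.dotProduct_genLyap_nonneg (A := A) (C := C) (v := v) (by rw [hq]; linarith)
  have h5 := (posSemidef_real_iff.1 hTY).2 v
  have h6 := (posDef_real_iff.1 hTV).2 v hv
  simp only [genLyap_add, genLyap_smul, add_mulVec, smul_mulVec, dotProduct_add, dotProduct_smul,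
    smul_eq_mul, neg_mulVec, dotProduct_neg] at hge h5 h6
  nlinarith

lemma IsLyapStable.eq_zero (h : IsLyapStable A C) (hY : Y.IsSymm) (h0 : genLyap A C Y = 0) :
    Y = 0 := by
  have h1 : Y.PosSemidef := h.posSemidef hY (by rw [h0, neg_zero]; exact PosSemidef.zero)
  have h2 : (-Y).PosSemidef :=
    h.posSemidef hY.neg (by rw [genLyap_neg, h0, neg_zero, neg_zero]; exact PosSemidef.zero)
  have h3 := h1.norm_le_trace
  have h4 := h2.trace_nonneg
  rw [trace_neg] at h4
  exact norm_le_zero_iff.1 (by linarith)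

lemma exists_genLyap_eq (hinj : ∀ X : Matrix (Fin n) (Fin n) ℝ, X.IsSymm → genLyap A C X = 0 →
    X = 0) (hH : H.IsSymm) : ∃ Z : Matrix (Fin n) (Fin n) ℝ, Z.IsSymm ∧ genLyap A C Z = H := by
  -- The antisymmetric part of T X is X - Xᵀ, so T X is symmetric only for symmetric X. Injectivity
  -- and surjectivity on symmetric matrices thus reduce to those of an endomorphism of the full
  -- matrix space.
  let T : Matrix (Fin n) (Fin n) ℝ →ₗ[ℝ] Matrix (Fin n) (Fin n) ℝ :=
    { toFun := fun X => genLyap A C (X + Xᵀ) + (X - Xᵀ)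
      map_add' := fun X Y => by
        simp only [transpose_add, genLyap_add]
        abel
      map_smul' := fun a X => by
        simp only [transpose_smul, ← smul_add, genLyap_smul, ← smul_sub, RingHom.id_apply] }
  have hT : ∀ X, T X = genLyap A C (X + Xᵀ) + (X - Xᵀ) := fun X => rfl
  have hsymm : ∀ X, (T X).IsSymm → X.IsSymm := by
    intro X hX
    have h1 := hX.eq
    rw [hT, transpose_add, genLyap_transpose, transpose_sub, transpose_add, transpose_transpose,
      add_comm Xᵀ X] at h1
    have h2 := add_left_cancel h1
    have h3 : (2 : ℝ) • (Xᵀ - X) = 0 := by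
      rw [two_smul]
      nth_rw 1 [h2]
      abel
    exact sub_eq_zero.1 ((smul_eq_zero.1 h3).resolve_left two_ne_zero)
  have hker : Function.Injective T := by
    rw [injective_iff_map_eq_zero]
    intro X hX
    have hs : X.IsSymm := hsymm X (by rw [hX]; exact isSymm_zero)
    rw [hT, hs.eq, sub_self, add_zero] at hX
    have h2 := hinj (X + X) (hs.add hs) hX
    rw [← two_smul ℝ X] at h2
    exact (smul_eq_zero.1 h2).resolve_left two_ne_zero
  obtain ⟨X, hX⟩ := LinearMap.injective_iff_surjective.1 hker H
  have hs : X.IsSymm := hsymm X (by rw [hX]; exact hH)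
  refine ⟨X + X, hs.add hs, ?_⟩
  rw [← hX, hT, hs.eq, sub_self, add_zero]

lemma IsLyapStable.exists_eq (h : IsLyapStable A C) (hH : H.IsSymm) :
    ∃ Z : Matrix (Fin n) (Fin n) ℝ, Z.IsSymm ∧ genLyap A C Z = H :=
  exists_genLyap_eq (fun _ hX h0 => h.eq_zero hX h0) hH

lemma PosSemidef.posDef_of_genLyap (hX : X.PosSemidef) (hTX : (-(genLyap A C X)).PosDef) :
    X.PosDef := by
  rw [posDef_real_iff]
  have hX' := posSemidef_real_iff.1 hX
  refine ⟨hX'.1, fun v hv => (hX'.2 v).lt_of_ne' fun h0 => ?_⟩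
  have h1 := hX.dotProduct_genLyap_nonneg (A := A) (C := C) h0
  have h2 := (posDef_real_iff.1 hTX).2 v hv
  rw [neg_mulVec, dotProduct_neg] at h2
  linarith

/-- If the generalized Lyapunov operator on symmetric matrices has no nonnegative real
eigenvalue, then a Lyapunov certificate of stability exists. -/
lemma isLyapStable_of_eigenvalues
    (h : ∀ s : ℝ, 0 ≤ s → ∀ X : Matrix (Fin n) (Fin n) ℝ, X.IsSymm → genLyap A C X = s • X →
      X = 0) : IsLyapStable A C := by
  -- Continuation in the shift: the operator minus s has a certificate for large s, and the aim is
  -- to show that the infimum of such s ≥ 0 is 0 and is attained.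
  set J : Set ℝ := {s | 0 ≤ s ∧ IsLyapStable (A - (s / 2) • 1) C} with hJ
  have hbdd : BddBelow J := ⟨0, fun s hs => hs.1⟩
  have hcert : ∀ (s : ℝ) (X : Matrix (Fin n) (Fin n) ℝ) (v : Fin n → ℝ),
      v ⬝ᵥ (-(genLyap (A - (s / 2) • 1) C X)) *ᵥ v
        = s * (v ⬝ᵥ X *ᵥ v) - v ⬝ᵥ genLyap A C X *ᵥ v := by
    intro s X v
    rw [genLyap_shift]
    simp [sub_mulVec, dotProduct_sub, smul_mulVec]
  have hne : J.Nonempty := by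
    refine ⟨‖genLyap A C 1‖ + 1, by positivity, 1, PosDef.one, ?_⟩
    rw [posDef_real_iff]
    refine ⟨IsSymm.neg (IsSymm.genLyap isSymm_one), fun v hv => ?_⟩
    rw [hcert, one_mulVec]
    linarith [le_of_abs_le (abs_dotProduct_mulVec_le (genLyap A C 1) v), dotProduct_self_pos' hv]
  set s₀ := sInf J with hs₀
  have hs₀0 : 0 ≤ s₀ := le_csInf hne fun s hs => hs.1
  obtain ⟨X, hXs, hX⟩ : ∃ X : Matrix (Fin n) (Fin n) ℝ, X.IsSymm ∧
      genLyap (A - (s₀ / 2) • 1) C X = -1 := by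
    refine exists_genLyap_eq (fun X hX h0 => h s₀ hs₀0 X hX ?_) isSymm_one.neg
    rwa [genLyap_shift, sub_eq_zero] at h0
  have hXq : ∀ v, v ⬝ᵥ genLyap A C X *ᵥ v = s₀ * (v ⬝ᵥ X *ᵥ v) - v ⬝ᵥ v := by
    intro v
    have h1 := hcert s₀ X v
    rw [hX, neg_neg, one_mulVec] at h1
    linarith
  -- For |d| ≤ η the matrix 1 + dX is still positive definite, so X keeps a strict Lyapunov
  -- inequality for all shifts within η of s₀.
  set η : ℝ := 1 / (‖X‖ + 1) with hη
  have hηpos : 0 < η := by positivity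
  have hηX : η * ‖X‖ < 1 := by
    rw [hη, div_mul_eq_mul_div, one_mul, div_lt_one (by positivity)]
    linarith
  have hpert : ∀ (d : ℝ) (v : Fin n → ℝ), |d| ≤ η → v ≠ 0 → 0 < v ⬝ᵥ v + d * (v ⬝ᵥ X *ᵥ v) := by
    intro d v hd hv
    have h1 := abs_dotProduct_mulVec_le X v
    have h2 := dotProduct_self_pos' hv
    have h3 : |d * (v ⬝ᵥ X *ᵥ v)| ≤ η * (‖X‖ * (v ⬝ᵥ v)) := by
      rw [abs_mul]
      gcongr
    have h4 := neg_le_of_abs_le h3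
    nlinarith
  -- Some s in J lies within η of s₀; the comparison principle for that shift applies to X.
  have hpsd : X.PosSemidef := by
    obtain ⟨s, hs, hlt⟩ := exists_lt_of_csInf_lt hne (show sInf J < s₀ + η by linarith)
    have hle : s₀ ≤ s := csInf_le hbdd hs
    refine hs.2.posSemidef hXs ?_
    refine PosDef.posSemidef ?_
    rw [posDef_real_iff]
    refine ⟨hXs.genLyap.neg, fun v hv => ?_⟩
    rw [hcert, hXq]
    have := hpert (s - s₀) v (by rw [abs_of_nonneg (by linarith)]; linarith) hv
    linarith
  have hpd : X.PosDef := by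
    refine hpsd.posDef_of_genLyap (A := A - (s₀ / 2) • 1) (C := C) ?_
    rw [hX, neg_neg]
    exact PosDef.one
  rcases hs₀0.eq_or_lt with h0 | h0
  · refine ⟨X, hpd, ?_⟩
    rw [← h0, zero_div, zero_smul, sub_zero] at hX
    rw [hX, neg_neg]
    exact PosDef.one
  -- If s₀ > 0, X also certifies a smaller shift, against the choice of s₀.
  · exfalso
    set s₁ := max 0 (s₀ - η) with hs₁
    have h1 : s₁ < s₀ := max_lt h0 (by linarith)
    have h2 : s₀ - η ≤ s₁ := le_max_right _ _
    refine (csInf_le hbdd (a := s₁) ⟨le_max_left _ _, X, hpd, ?_⟩).not_gt h1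
    rw [posDef_real_iff]
    refine ⟨hXs.genLyap.neg, fun v hv => ?_⟩
    rw [hcert, hXq]
    have := hpert (s₁ - s₀) v (by rw [abs_of_neg (by linarith)]; linarith) hv
    linarith

end GeneralizedLyapunov

end Matrix

/-! ### Completion of squares and comparison with the stabilizing solution. -/

namespace LQSystem

open Matrix

variable {n m₁ m₂ : ℕ} (S : LQSystem n m₁ m₂)

variable {K : Matrix (Fin m₁) (Fin n) ℝ} {L : Matrix (Fin m₂) (Fin n) ℝ}
  {P P' Pst V : Matrix (Fin n) (Fin n) ℝ}

/-- The gain `K` is stabilizing in the sense of a Lyapunov certificate. -/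
def IsStableGain (K : Matrix (Fin m₁) (Fin n) ℝ) (L : Matrix (Fin m₂) (Fin n) ℝ) : Prop :=
  IsLyapStable (S.drift K L) (S.diffusion K)

lemma lyap_eq_genLyap : S.lyap K L P = genLyap (S.drift K L) (S.diffusion K) P := rfl

lemma isStableGain_of_mem_admissibleGains (hK : K ∈ S.admissibleGains L) :
    S.IsStableGain K L := by
  refine isLyapStable_of_eigenvalues fun s hs X hX hXs => ?_
  by_contra hX0
  have hmem : (s : ℂ) ∈ S.lyapSpectrum K L := by
    refine ⟨X.map Complex.ofReal, ?_, ?_, ?_⟩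
    · rw [IsSymm, ← transpose_map, hX.eq]
    · intro h0
      refine hX0 (Matrix.ext fun i j => ?_)
      simpa using congrFun (congrFun h0 i) j
    · have hmul : ∀ {a b c : ℕ} (M : Matrix (Fin a) (Fin b) ℝ) (N : Matrix (Fin b) (Fin c) ℝ),
          M.map Complex.ofReal * N.map Complex.ofReal = (M * N).map Complex.ofReal := by
        intro a b c M N
        exact (Matrix.map_mul (f := Complex.ofRealHom)).symm
      have hadd : ∀ M N : Matrix (Fin n) (Fin n) ℝ,
          M.map Complex.ofReal + N.map Complex.ofReal = (M + N).map Complex.ofReal := by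
        intro M N
        ext i j
        simp
      rw [← transpose_map, ← transpose_map, hmul, hmul, hmul, hmul, hadd, hadd]
      change (genLyap (S.drift K L) (S.diffusion K) X).map Complex.ofReal = _
      rw [hXs]
      ext i j
      simp
  have h1 := hK hmem
  simp only [Set.mem_ofPred_eq, Complex.ofReal_re] at h1
  linarith

/-- The control weight `R + Dᵀ P D`. -/
def weight (P : Matrix (Fin n) (Fin n) ℝ) : Matrix (Fin m₁) (Fin m₁) ℝ :=
  S.R + S.Dᵀ * P * S.D

/-- The left-hand side of the Lyapunov-type equation for the gains `K`, `L`. -/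
def residual (K : Matrix (Fin m₁) (Fin n) ℝ) (L : Matrix (Fin m₂) (Fin n) ℝ)
    (P : Matrix (Fin n) (Fin n) ℝ) : Matrix (Fin n) (Fin n) ℝ :=
  S.lyap K L P + (S.Q - S.γ ^ 2 • (Lᵀ * L)) + Kᵀ * S.R * K

/-- The cross term `Bᵀ P + Dᵀ P (C - D K)`. -/
def cross (K : Matrix (Fin m₁) (Fin n) ℝ) (P : Matrix (Fin n) (Fin n) ℝ) :
    Matrix (Fin m₁) (Fin n) ℝ :=
  S.Bᵀ * P + S.Dᵀ * P * S.diffusion K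

lemma R_isSymm : S.R.IsSymm := (posDef_real_iff.1 S.R_posDef).1

lemma residual_sub : S.residual K L P - S.residual K L P' = S.lyap K L (P - P') := by
  rw [residual, residual, lyap_eq_genLyap, lyap_eq_genLyap, lyap_eq_genLyap, genLyap_sub]
  abel

lemma drift_add (E : Matrix (Fin m₁) (Fin n) ℝ) : S.drift (K + E) L = S.drift K L - S.B * E := by
  rw [drift, drift, Matrix.mul_add]
  abel

lemma diffusion_add (E : Matrix (Fin m₁) (Fin n) ℝ) :
    S.diffusion (K + E) = S.diffusion K - S.D * E := by
  rw [diffusion, diffusion, Matrix.mul_add]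
  abel

lemma lyap_add_gain (hP : P.IsSymm) (E : Matrix (Fin m₁) (Fin n) ℝ) :
    S.lyap (K + E) L P = S.lyap K L P - Eᵀ * S.cross K P - (S.cross K P)ᵀ * E
      + Eᵀ * (S.Dᵀ * P * S.D) * E := by
  rw [lyap, lyap, drift_add, diffusion_add, cross]
  simp only [transpose_sub, transpose_add, transpose_mul, transpose_transpose, hP.eq,
    Matrix.sub_mul, Matrix.mul_sub, Matrix.mul_add, Matrix.add_mul, Matrix.mul_assoc]
  abel

lemma weight_mul_gainK (hW : (S.weight P).PosDef) :
    S.weight P * S.gainK P = S.Bᵀ * P + S.Dᵀ * P * S.C := by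
  have h : IsUnit (S.weight P).det := (isUnit_iff_isUnit_det _).1 hW.isUnit
  have hg : S.gainK P = (S.weight P)⁻¹ * (S.Bᵀ * P + S.Dᵀ * P * S.C) := rfl
  rw [hg, mul_nonsing_inv_cancel_left _ _ h]

lemma cross_eq (hW : (S.weight P).PosDef) :
    S.cross K P = S.weight P * S.gainK P - S.Dᵀ * P * S.D * K := by
  rw [weight_mul_gainK S hW, cross, diffusion]
  simp only [Matrix.mul_sub, Matrix.mul_assoc]
  abel

/-- Completion of squares. -/
lemma residual_eq (hP : P.IsSymm) (hW : (S.weight P).PosDef) :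
    S.residual K L P = S.residual (S.gainK P) L P
      + (K - S.gainK P)ᵀ * S.weight P * (K - S.gainK P) := by
  obtain ⟨E, rfl⟩ : ∃ E, K = S.gainK P + E := ⟨K - S.gainK P, by abel⟩
  have hc : S.cross (S.gainK P) P = S.R * S.gainK P := by
    rw [cross_eq S hW, weight, Matrix.add_mul]
    abel
  rw [residual, residual, lyap_add_gain S hP, hc, add_sub_cancel_left, weight]
  simp only [transpose_add, transpose_mul, S.R_isSymm.eq, Matrix.mul_add, Matrix.add_mul,
    Matrix.mul_assoc]
  abel

variable {S}

lemma IsLyapSolution.residual_eq_zero (h : S.IsLyapSolution K L P) : S.residual K L P = 0 := h.2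

lemma IsStabilizingSolution.isSymm (h : S.IsStabilizingSolution L Pst) : Pst.IsSymm :=
  h.solution.1

lemma IsStabilizingSolution.weight_posDef (h : S.IsStabilizingSolution L Pst) :
    (S.weight Pst).PosDef := h.posDef

lemma IsStabilizingSolution.isStableGain (h : S.IsStabilizingSolution L Pst) :
    S.IsStableGain (S.gainK Pst) L := S.isStableGain_of_mem_admissibleGains h.stabilizing

lemma IsStabilizingSolution.residual_eq (h : S.IsStabilizingSolution L Pst)
    (K : Matrix (Fin m₁) (Fin n) ℝ) :
    S.residual K L Pst = (K - S.gainK Pst)ᵀ * S.weight Pst * (K - S.gainK Pst) := by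
  rw [LQSystem.residual_eq S h.isSymm h.weight_posDef, h.solution.residual_eq_zero, zero_add]

/-- The Lyapunov operator of K sends P - Pst to minus the square left over from completing the
square at Pst, so the comparison principle applies. -/
lemma IsStabilizingSolution.posSemidef_sub (h : S.IsStabilizingSolution L Pst)
    (hK : S.IsStableGain K L) (hP : S.IsLyapSolution K L P) : (P - Pst).PosSemidef := by
  refine hK.posSemidef (hP.1.sub h.isSymm) ?_
  rw [← lyap_eq_genLyap, ← residual_sub, hP.residual_eq_zero, h.residual_eq, zero_sub, neg_neg]
  exact posSemidef_conj h.weight_posDef.posSemidef _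

/-! ### Estimates uniform over the sublevel set. -/

lemma weight_eq_add (P Pst : Matrix (Fin n) (Fin n) ℝ) :
    S.weight P = S.weight Pst + S.Dᵀ * (P - Pst) * S.D := by
  rw [weight, weight, Matrix.mul_sub, Matrix.sub_mul]
  abel

lemma weight_posDef_of_posSemidef_sub (hst : (S.weight Pst).PosDef) (hX : (P - Pst).PosSemidef) :
    (S.weight P).PosDef := by
  rw [weight_eq_add P Pst]
  exact hst.add_posSemidef (posSemidef_conj hX S.D)

lemma norm_weight_le {ρ : ℝ} (hX : (P - Pst).PosSemidef) (htr : (P - Pst).trace ≤ ρ) :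
    ‖S.weight P‖ ≤ ‖S.weight Pst‖ + ‖S.D‖ * ρ * ‖S.D‖ := by
  have h0 : ‖P - Pst‖ ≤ ρ := hX.norm_le_trace.trans htr
  rw [weight_eq_add P Pst]
  refine (norm_add_le _ _).trans ?_
  gcongr
  refine (frobenius_norm_mul _ _).trans ?_
  gcongr
  refine (frobenius_norm_mul _ _).trans ?_
  rw [frobenius_norm_transpose]
  gcongr

/-- The gains `𝒦¹(P)` are bounded uniformly over the `P ≥ Pst` with `Tr (P - Pst) ≤ ρ`. -/
lemma exists_norm_gainK_sub_le (hst : (S.weight Pst).PosDef) {ρ : ℝ} (hρ : 0 ≤ ρ) :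
    ∃ e : ℝ, 0 ≤ e ∧ ∀ P : Matrix (Fin n) (Fin n) ℝ, (P - Pst).PosSemidef →
      (P - Pst).trace ≤ ρ → ‖S.gainK P - S.gainK Pst‖ ≤ e := by
  obtain ⟨w, hw, hwW⟩ := hst.exists_pos_mul_le
  set ν : ℝ := (‖S.B‖ + ‖S.D‖ * ‖S.diffusion (S.gainK Pst)‖) * ρ with hν
  have hν0 : 0 ≤ ν := by positivity
  refine ⟨n * ν / w, by positivity, fun P hX htr => ?_⟩
  set E := S.gainK P - S.gainK Pst with hE
  have hX0 : ‖P - Pst‖ ≤ ρ := hX.norm_le_trace.trans htr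
  -- The right side is linear in P - Pst. Pairing with E and using weight P ≥ weight Pst ≥ w bounds
  -- E without any bound on the inverse of the weight.
  have hWE : S.weight P * E = S.cross (S.gainK Pst) (P - Pst) := by
    rw [hE, Matrix.mul_sub, S.weight_mul_gainK (weight_posDef_of_posSemidef_sub hst hX)]
    nth_rw 1 [weight_eq_add P Pst]
    rw [Matrix.add_mul, S.weight_mul_gainK hst, cross, diffusion]
    simp only [Matrix.mul_sub, Matrix.sub_mul, Matrix.mul_assoc]
    abel
  clear_value E
  have hcross : ‖S.cross (S.gainK Pst) (P - Pst)‖ ≤ ν := by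
    refine (norm_add_le _ _).trans ?_
    have h1 := frobenius_norm_mul S.Bᵀ (P - Pst)
    have h2 := frobenius_norm_mul (S.Dᵀ * (P - Pst)) (S.diffusion (S.gainK Pst))
    have h3 := frobenius_norm_mul S.Dᵀ (P - Pst)
    rw [frobenius_norm_transpose] at h1 h3
    have h4 : ‖S.B‖ * ‖P - Pst‖ ≤ ‖S.B‖ * ρ := by gcongr
    have h5 : ‖S.Dᵀ * (P - Pst)‖ * ‖S.diffusion (S.gainK Pst)‖
        ≤ (‖S.D‖ * ρ) * ‖S.diffusion (S.gainK Pst)‖ := by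
      gcongr
      exact h3.trans (by gcongr)
    rw [hν]
    linarith
  have hpsd : (Eᵀ * (S.weight P - w • 1) * E).PosSemidef := by
    refine posSemidef_conj (posSemidef_real_iff.2 ⟨?_, fun v => ?_⟩) E
    · exact (posDef_real_iff.1 (weight_posDef_of_posSemidef_sub hst hX)).1.sub
        (isSymm_one.smul w)
    · have h1 := hwW v
      have h2 := (posSemidef_real_iff.1 (posSemidef_conj hX S.D)).2 v
      rw [weight_eq_add P Pst]
      simp only [sub_mulVec, add_mulVec, dotProduct_sub, dotProduct_add, smul_mulVec, one_mulVec,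
        dotProduct_smul, smul_eq_mul] at h2 ⊢
      linarith
  have htrace : w * ‖E‖ ^ 2 ≤ (Eᵀ * S.cross (S.gainK Pst) (P - Pst)).trace := by
    have h1 := hpsd.trace_nonneg
    rw [Matrix.mul_sub, Matrix.sub_mul, Matrix.mul_assoc Eᵀ (S.weight P), hWE, trace_sub,
      Matrix.mul_smul, Matrix.smul_mul, trace_smul, Matrix.mul_one, ← norm_sq_eq_trace,
      smul_eq_mul] at h1
    linarith
  have hup : (Eᵀ * S.cross (S.gainK Pst) (P - Pst)).trace ≤ n * (‖E‖ * ν) := by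
    refine (trace_le_card_mul_norm _).trans ?_
    gcongr
    refine (frobenius_norm_mul _ _).trans ?_
    rw [frobenius_norm_transpose]
    gcongr
  rw [le_div_iff₀ hw]
  rcases (norm_nonneg E).eq_or_lt with h0 | h0
  · rw [← h0, zero_mul]
    positivity
  · refine le_of_mul_le_mul_left ?_ h0
    linarith

lemma exists_genLyap_eq_neg_one {A C : Matrix (Fin n) (Fin n) ℝ} (h : IsLyapStable A C) :
    ∃ V : Matrix (Fin n) (Fin n) ℝ, V.PosDef ∧ genLyap A C V = -1 := by
  obtain ⟨V, hVs, hV⟩ := h.exists_eq (H := -1) isSymm_one.neg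
  have h1 : (-(genLyap A C V)).PosDef := by
    rw [hV, neg_neg]
    exact PosDef.one
  exact ⟨V, (h.posSemidef hVs h1.posSemidef).posDef_of_genLyap h1, hV⟩

/-- A Lyapunov certificate of the gain `K` changes under a perturbation of the gain by at most
half of its margin plus a multiple of the square of the perturbation. -/
lemma exists_lyap_perturbation (hV : V.IsSymm) (hKV : S.lyap K L V = -1) :
    ∃ M : ℝ, 0 ≤ M ∧ ∀ (E : Matrix (Fin m₁) (Fin n) ℝ) (v : Fin n → ℝ),
      v ⬝ᵥ S.lyap (K + E) L V *ᵥ v ≤ -(1 / 2) * (v ⬝ᵥ v) + M * ((E *ᵥ v) ⬝ᵥ (E *ᵥ v)) := by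
  set N := S.cross K V with hN
  refine ⟨2 * ‖N‖ ^ 2 + ‖S.Dᵀ * V * S.D‖, by positivity, fun E v => ?_⟩
  have hq : v ⬝ᵥ S.lyap (K + E) L V *ᵥ v = -(v ⬝ᵥ v) - 2 * ((E *ᵥ v) ⬝ᵥ N *ᵥ v)
      + (E *ᵥ v) ⬝ᵥ (S.Dᵀ * V * S.D) *ᵥ (E *ᵥ v) := by
    rw [S.lyap_add_gain hV, hKV, ← hN]
    simp only [add_mulVec, sub_mulVec, neg_mulVec, one_mulVec, dotProduct_add, dotProduct_sub,
      dotProduct_neg]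
    have h1 : v ⬝ᵥ (Eᵀ * N) *ᵥ v = (E *ᵥ v) ⬝ᵥ N *ᵥ v := by
      rw [← mulVec_mulVec, dotProduct_transpose_mulVec, dotProduct_comm]
    have h2 : v ⬝ᵥ (Nᵀ * E) *ᵥ v = (E *ᵥ v) ⬝ᵥ N *ᵥ v := by
      rw [← mulVec_mulVec, dotProduct_transpose_mulVec]
    have h3 : v ⬝ᵥ (Eᵀ * (S.Dᵀ * V * S.D) * E) *ᵥ v
        = (E *ᵥ v) ⬝ᵥ (S.Dᵀ * V * S.D) *ᵥ (E *ᵥ v) := by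
      exact dotProduct_conj_mulVec _ E v
    rw [h1, h2, h3]
    ring
  have h1 := neg_le_of_abs_le (abs_dotProduct_le_norm (E *ᵥ v) (N *ᵥ v))
  have h2 := le_of_abs_le (abs_dotProduct_mulVec_le (S.Dᵀ * V * S.D) (E *ᵥ v))
  have h3 := norm_toLp_mulVec_le N v
  rw [hq, dotProduct_self_eq_norm_sq v]
  rw [dotProduct_self_eq_norm_sq (E *ᵥ v)] at h2 ⊢
  set x := ‖WithLp.toLp 2 (E *ᵥ v)‖
  set y := ‖WithLp.toLp 2 v‖
  have hx : 0 ≤ x := norm_nonneg _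
  have h4 : x * ‖WithLp.toLp 2 (N *ᵥ v)‖ ≤ x * (‖N‖ * y) := by gcongr
  -- Young's inequality 2‖N‖xy ≤ y²/2 + 2‖N‖²x² costs half of the margin.
  nlinarith [sq_nonneg (2 * (‖N‖ * x) - y)]


lemma IsLyapSolution.isSymm (h : S.IsLyapSolution K L P) : P.IsSymm := h.1

/-- For the perturbed improved gain, the Lyapunov operator at `P - Pst`. -/
lemma lyap_sub_of_gainK_add (h : S.IsStabilizingSolution L Pst) (hP : S.IsLyapSolution K L P)
    (hW : (S.weight P).PosDef) (δ : Matrix (Fin m₁) (Fin n) ℝ) :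
    S.lyap (S.gainK P + δ) L (P - Pst) =
      -((K - S.gainK P)ᵀ * S.weight P * (K - S.gainK P)) + δᵀ * S.weight P * δ
        - (S.gainK P + δ - S.gainK Pst)ᵀ * S.weight Pst * (S.gainK P + δ - S.gainK Pst) := by
  have h1 := residual_eq S (K := K) (L := L) hP.isSymm hW
  rw [hP.residual_eq_zero] at h1
  rw [← residual_sub, residual_eq S hP.isSymm hW, h.residual_eq, add_sub_cancel_left,
    eq_neg_of_add_eq_zero_left h1.symm]

/-- The decrease identity: the defect of the old gain lowers the solution, the disturbance raises
it. -/
lemma lyap_sub_of_isLyapSolution_gainK_add (hP : S.IsLyapSolution K L P)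
    (hW : (S.weight P).PosDef) {δ : Matrix (Fin m₁) (Fin n) ℝ}
    (hP' : S.IsLyapSolution (S.gainK P + δ) L P') :
    S.lyap (S.gainK P + δ) L (P' - P) =
      (K - S.gainK P)ᵀ * S.weight P * (K - S.gainK P) - δᵀ * S.weight P * δ := by
  have h1 := residual_eq S (K := K) (L := L) hP.isSymm hW
  rw [hP.residual_eq_zero] at h1
  rw [← residual_sub, hP'.residual_eq_zero, residual_eq S hP.isSymm hW, add_sub_cancel_left,
    eq_neg_of_add_eq_zero_left h1.symm]
  abel

/-- The distance to the stabilizing solution is controlled by the defect of the gain `K` from the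
improved gain. -/
lemma trace_sub_le_norm_defect (h : S.IsStabilizingSolution L Pst) (hV : V.IsSymm)
    (hKV : S.lyap (S.gainK Pst) L V = -1) (hP : S.IsLyapSolution K L P)
    (hW : (S.weight P).PosDef) :
    (P - Pst).trace ≤ ‖(K - S.gainK P)ᵀ * S.weight P * (K - S.gainK P)‖ * V.trace := by
  set F := (K - S.gainK P)ᵀ * S.weight P * (K - S.gainK P) with hF
  have hFs : F.IsSymm := (posSemidef_real_iff.1 (posSemidef_conj hW.posSemidef _)).1
  have h0 := residual_eq S (K := K) (L := L) hP.isSymm hW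
  rw [hP.residual_eq_zero] at h0
  have h1 : S.lyap (S.gainK Pst) L (P - Pst)
      = -F + (S.gainK Pst - S.gainK P)ᵀ * S.weight P * (S.gainK Pst - S.gainK P) := by
    rw [← residual_sub, residual_eq S hP.isSymm hW, h.solution.residual_eq_zero,
      eq_neg_of_add_eq_zero_left h0.symm, sub_zero]
  -- The operator at the optimal gain sends P - Pst to at least -F ≥ -‖F‖·1, which is its value at
  -- ‖F‖V; hence P - Pst ≤ ‖F‖V.
  have h2 : (‖F‖ • V - (P - Pst)).PosSemidef := by
    refine h.isStableGain.posSemidef ((hV.smul _).sub (hP.isSymm.sub h.isSymm)) ?_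
    rw [genLyap_sub, genLyap_smul, ← lyap_eq_genLyap, ← lyap_eq_genLyap, h1, hKV]
    have h3 := posSemidef_conj hW.posSemidef (S.gainK Pst - S.gainK P)
    have h4 : (‖F‖ • (1 : Matrix (Fin n) (Fin n) ℝ) - F).PosSemidef := by
      refine posSemidef_real_iff.2 ⟨(isSymm_one.smul _).sub hFs, fun v => ?_⟩
      have := le_of_abs_le (abs_dotProduct_mulVec_le F v)
      simp only [sub_mulVec, smul_mulVec, one_mulVec, dotProduct_sub, dotProduct_smul, smul_eq_mul]
      linarith
    convert h4.add h3 using 1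
    rw [smul_neg]
    abel
  have h5 := h2.trace_nonneg
  rw [trace_sub, trace_smul, smul_eq_mul] at h5
  linarith

lemma exists_norm_genLyap_le (K : Matrix (Fin m₁) (Fin n) ℝ) (L : Matrix (Fin m₂) (Fin n) ℝ)
    (e : ℝ) : ∃ c : ℝ, 0 ≤ c ∧ ∀ E : Matrix (Fin m₁) (Fin n) ℝ, ‖E‖ ≤ e →
      ∀ X, ‖S.lyap (K + E) L X‖ ≤ c * ‖X‖ := by
  refine ⟨2 * (‖S.drift K L‖ + ‖S.B‖ * |e|) + (‖S.diffusion K‖ + ‖S.D‖ * |e|) ^ 2,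
    by positivity, fun E hE X => ?_⟩
  replace hE := hE.trans (le_abs_self e)
  refine norm_genLyap_le.trans ?_
  rw [drift_add, diffusion_add]
  have h1 : ‖S.drift K L - S.B * E‖ ≤ ‖S.drift K L‖ + ‖S.B‖ * |e| :=
    (norm_sub_le _ _).trans (by gcongr; exact (frobenius_norm_mul _ _).trans (by gcongr))
  have h2 : ‖S.diffusion K - S.D * E‖ ≤ ‖S.diffusion K‖ + ‖S.D‖ * |e| :=
    (norm_sub_le _ _).trans (by gcongr; exact (frobenius_norm_mul _ _).trans (by gcongr))
  gcongr

/-- A common Lyapunov certificate for all gains which are close to the improved gain of some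
`P` in the sublevel set. -/
lemma exists_uniform_certificate (h : S.IsStabilizingSolution L Pst) {ρ : ℝ} (hρ : 0 < ρ)
    (hV : V.PosDef) (hKV : S.lyap (S.gainK Pst) L V = -1) :
    ∃ ε a : ℝ, 0 < ε ∧ ε ≤ 1 ∧ 0 ≤ a ∧
      ∀ (K : Matrix (Fin m₁) (Fin n) ℝ) (P : Matrix (Fin n) (Fin n) ℝ)
        (δ : Matrix (Fin m₁) (Fin n) ℝ), S.IsLyapSolution K L P → (P - Pst).PosSemidef →
        (P - Pst).trace ≤ ρ → ‖δ‖ ≤ ε → ∀ v : Fin n → ℝ,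
        v ⬝ᵥ S.lyap (S.gainK P + δ) L (V + a • (P - Pst)) *ᵥ v ≤ -(1 / 4) * (v ⬝ᵥ v) := by
  obtain ⟨M, hM, hpert⟩ := exists_lyap_perturbation (posDef_real_iff.1 hV).1 hKV
  obtain ⟨w, hw, hwW⟩ := h.weight_posDef.exists_pos_mul_le
  set b : ℝ := ‖S.weight Pst‖ + ‖S.D‖ * ρ * ‖S.D‖ with hb
  have hb0 : 0 ≤ b := by positivity
  -- Changing the gain by E costs V the term M|Ev|², while P - Pst contributes -w|Ev|²; the weight a
  -- makes them cancel.
  set a : ℝ := M / w with ha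
  have ha0 : 0 ≤ a := by positivity
  have haw : a * w = M := div_mul_cancel₀ _ hw.ne'
  have hden : 0 < 4 * (a * b) + 1 := by positivity
  -- This radius gives ab‖δ‖² ≤ 1/4, leaving -1/2 + 1/4 = -1/4.
  refine ⟨1 / (4 * (a * b) + 1), a, by positivity, ?_, ha0, fun K P δ hP hX htr hδ v => ?_⟩
  · rw [div_le_one hden]
    linarith [mul_nonneg ha0 hb0]
  have hW := weight_posDef_of_posSemidef_sub h.weight_posDef hX
  set E := S.gainK P + δ - S.gainK Pst with hE
  have hgain : S.gainK P + δ = S.gainK Pst + E := by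
    rw [hE]
    abel
  have h1 := hpert E v
  rw [← hgain] at h1
  have h2 : v ⬝ᵥ S.lyap (S.gainK P + δ) L (P - Pst) *ᵥ v
      ≤ b * ‖δ‖ ^ 2 * (v ⬝ᵥ v) - w * ((E *ᵥ v) ⬝ᵥ (E *ᵥ v)) := by
    rw [lyap_sub_of_gainK_add h hP hW, ← hE]
    have h3 := (posSemidef_real_iff.1 (posSemidef_conj hW.posSemidef (K - S.gainK P))).2 v
    have h4 := dotProduct_conj_mulVec_le (S.weight P) δ v
    have h5 := hwW (E *ᵥ v)
    have h6 : ‖S.weight P‖ * ‖δ‖ ^ 2 * (v ⬝ᵥ v) ≤ b * ‖δ‖ ^ 2 * (v ⬝ᵥ v) := by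
      have := dotProduct_self_nonneg' v
      gcongr
      exact norm_weight_le hX htr
    rw [← dotProduct_conj_mulVec] at h5
    simp only [sub_mulVec, add_mulVec, neg_mulVec, dotProduct_sub, dotProduct_add, dotProduct_neg]
    linarith
  have h7 : a * b * ‖δ‖ ^ 2 ≤ 1 / 4 := by
    have h8 : ‖δ‖ ≤ 1 := hδ.trans (by
      rw [div_le_one hden]
      linarith [mul_nonneg ha0 hb0])
    have h9 : ‖δ‖ * (4 * (a * b) + 1) ≤ 1 := by rwa [le_div_iff₀ hden] at hδ
    have h10 := norm_nonneg δ
    have h11 : ‖δ‖ ^ 2 ≤ ‖δ‖ := by nlinarith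
    have h12 : a * b * ‖δ‖ ^ 2 ≤ a * b * ‖δ‖ := by gcongr
    nlinarith
  have h13 := mul_le_mul_of_nonneg_left h2 ha0
  have h14 := mul_le_mul_of_nonneg_right h7 (dotProduct_self_nonneg' v)
  have h15 : a * w * ((E *ᵥ v) ⬝ᵥ (E *ᵥ v)) = M * ((E *ᵥ v) ⬝ᵥ (E *ᵥ v)) := by rw [haw]
  rw [lyap_eq_genLyap, genLyap_add, genLyap_smul, ← lyap_eq_genLyap, ← lyap_eq_genLyap,
    add_mulVec, smul_mulVec, dotProduct_add, dotProduct_smul, smul_eq_mul]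
  linarith

/-- One inexact policy iteration step: the perturbed improved gain is stabilizing, and the
distance to the stabilizing solution contracts up to the square of the disturbance. -/
lemma exists_step_constants (h : S.IsStabilizingSolution L Pst) {ρ : ℝ} (hρ : 0 < ρ) :
    ∃ ε θ c : ℝ, 0 < ε ∧ 0 < θ ∧ θ < 1 ∧ 0 < c ∧
      ∀ (K : Matrix (Fin m₁) (Fin n) ℝ) (P : Matrix (Fin n) (Fin n) ℝ)
        (δ : Matrix (Fin m₁) (Fin n) ℝ), S.IsStableGain K L → S.IsLyapSolution K L P →
        (P - Pst).trace ≤ ρ → ‖δ‖ ≤ ε →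
        S.IsStableGain (S.gainK P + δ) L ∧
        ∀ P', S.IsLyapSolution (S.gainK P + δ) L P' →
          (P' - Pst).trace ≤ θ * (P - Pst).trace + c * ‖δ‖ ^ 2 := by
  obtain ⟨V, hV, hKV⟩ := exists_genLyap_eq_neg_one h.isStableGain
  obtain ⟨ε, a, hε, hε1, ha, hcert⟩ := exists_uniform_certificate h hρ hV hKV
  obtain ⟨e, he, hgain⟩ := exists_norm_gainK_sub_le h.weight_posDef hρ.le
  obtain ⟨Λ, hΛ, hnorm⟩ := exists_norm_genLyap_le (S := S) (S.gainK Pst) L (e + 1)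
  have hVtr : 0 ≤ V.trace := hV.posSemidef.trace_nonneg
  -- Λ Tr V already suffices for Tr(P - Pst) ≤ τ Tr Z; adding 2 keeps 1 - 1/τ strictly between 0 and
  -- 1.
  set τ : ℝ := Λ * V.trace + 2 with hτ
  have hτ2 : 2 ≤ τ := by
    have := mul_nonneg hΛ hVtr
    linarith
  set b : ℝ := ‖S.weight Pst‖ + ‖S.D‖ * ρ * ‖S.D‖ with hb
  have hb0 : 0 ≤ b := by positivity
  have hτ1 : 1 / τ < 1 := by
    rw [div_lt_one (by linarith)]
    linarith
  have hτ0 : 0 < 1 / τ := by positivity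
  refine ⟨ε, 1 - 1 / τ, 4 * b * (V.trace + a * ρ) + 1, hε, by linarith, by linarith,
    by positivity, fun K P δ hK hP htr hδ => ?_⟩
  have hX := h.posSemidef_sub hK hP
  have hW := weight_posDef_of_posSemidef_sub h.weight_posDef hX
  have hc := hcert K P δ hP hX htr hδ
  set U := V + a • (P - Pst) with hU
  have hUpd : U.PosDef := hV.add_posSemidef (hX.smul ha)
  have hUs : U.IsSymm := (posDef_real_iff.1 hUpd).1
  have hst : S.IsStableGain (S.gainK P + δ) L := by
    refine ⟨U, hUpd, posDef_real_iff.2 ⟨hUs.genLyap.neg, fun v hv => ?_⟩⟩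
    rw [← lyap_eq_genLyap, neg_mulVec, dotProduct_neg]
    linarith [hc v, dotProduct_self_pos' hv]
  refine ⟨hst, fun P' hP' => ?_⟩
  set F := (K - S.gainK P)ᵀ * S.weight P * (K - S.gainK P) with hF
  have hFpsd : F.PosSemidef := posSemidef_conj hW.posSemidef _
  -- Z is the decrease that the undisturbed part of the step produces.
  obtain ⟨Z, hZs, hZ⟩ := hst.exists_eq (H := -F) (posSemidef_real_iff.1 hFpsd).1.neg
  have hZpsd : Z.PosSemidef := hst.posSemidef hZs (by rwa [hZ, neg_neg])
  have hFZ : ‖F‖ ≤ Λ * Z.trace := by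
    have h1 := hnorm (S.gainK P + δ - S.gainK Pst) (by
      calc ‖S.gainK P + δ - S.gainK Pst‖ = ‖(S.gainK P - S.gainK Pst) + δ‖ := by
            congr 1
            abel
        _ ≤ e + 1 := (norm_add_le _ _).trans (add_le_add (hgain P hX htr) (hδ.trans hε1))) Z
    rw [add_sub_cancel, lyap_eq_genLyap, hZ, norm_neg] at h1
    exact h1.trans (mul_le_mul_of_nonneg_left hZpsd.norm_le_trace hΛ)
  have hXZ : (P - Pst).trace ≤ τ * Z.trace := by
    have h1 := trace_sub_le_norm_defect h (posDef_real_iff.1 hV).1 hKV hP hW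
    have h2 := mul_le_mul_of_nonneg_right hFZ hVtr
    have h3 := hZpsd.trace_nonneg
    rw [hτ]
    linarith
  have hZlow : 1 / τ * (P - Pst).trace ≤ Z.trace := by
    rw [div_mul_eq_mul_div, one_mul, div_le_iff₀ (by linarith)]
    linarith
  set d : ℝ := 4 * (b * ‖δ‖ ^ 2) with hd
  have hd0 : 0 ≤ d := by positivity
  -- This is P' - P ≤ dU - Z. The defects cancel, and d = 4b‖δ‖² with the margin 1/4 of U dominates
  -- δᵀWδ.
  have hcomp : (d • U - Z - (P' - P)).PosSemidef := by
    refine hst.posSemidef (((hUs.smul d).sub hZs).sub (hP'.isSymm.sub hP.isSymm)) ?_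
    refine posSemidef_real_iff.2
      ⟨(((hUs.smul d).sub hZs).sub (hP'.isSymm.sub hP.isSymm)).genLyap.neg, fun v => ?_⟩
    rw [genLyap_sub, genLyap_sub, genLyap_smul, hZ, ← lyap_eq_genLyap, ← lyap_eq_genLyap,
      lyap_sub_of_isLyapSolution_gainK_add hP hW hP', ← hF]
    have h1 := dotProduct_conj_mulVec_le (S.weight P) δ v
    have h2 : ‖S.weight P‖ * ‖δ‖ ^ 2 * (v ⬝ᵥ v) ≤ b * ‖δ‖ ^ 2 * (v ⬝ᵥ v) := by
      have := dotProduct_self_nonneg' v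
      gcongr
      exact norm_weight_le hX htr
    have h3 := mul_le_mul_of_nonneg_left (hc v) hd0
    have h4 : d * (-(1 / 4) * (v ⬝ᵥ v)) = -(b * ‖δ‖ ^ 2 * (v ⬝ᵥ v)) := by
      rw [hd]
      ring
    simp only [neg_mulVec, sub_mulVec, smul_mulVec, dotProduct_neg, dotProduct_sub,
      dotProduct_smul, smul_eq_mul]
    linarith
  have h1 := hcomp.trace_nonneg
  have hUtr : U.trace ≤ V.trace + a * ρ := by
    rw [hU, trace_add, trace_smul, smul_eq_mul]
    gcongr
  have h2 := mul_le_mul_of_nonneg_left hUtr hd0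
  have h3 : d * (V.trace + a * ρ) = (4 * b * (V.trace + a * ρ)) * ‖δ‖ ^ 2 := by
    rw [hd]
    ring
  simp only [trace_sub, trace_smul, smul_eq_mul] at h1 hZlow ⊢
  nlinarith [sq_nonneg ‖δ‖]

end LQSystem

/-! ### Explicit comparison functions. -/

lemma isClassKL_mul_rpow {a θ : ℝ≥0} (ha : 0 < a) (hθ : 0 < θ) (hθ1 : θ < 1) :
    IsClassKL fun s t => a * s * θ ^ (t : ℝ) := by
  have hcont : Continuous fun t : ℝ≥0 => θ ^ (t : ℝ) :=
    continuous_iff_continuousAt.2 fun t =>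
      (NNReal.continuousAt_rpow (x := θ) (y := t) (Or.inl hθ.ne')).comp
        (f := fun t : ℝ≥0 => ((θ, (t : ℝ)) : ℝ≥0 × ℝ)) (by fun_prop)
  refine ⟨?_, fun t => ⟨by fun_prop, fun s s' hs => ?_, by simp⟩, fun s => ⟨fun t t' ht => ?_, ?_⟩⟩
  · exact (continuous_const.mul continuous_fst).mul (hcont.comp continuous_snd)
  · have h1 : 0 < θ ^ (t : ℝ) := NNReal.rpow_pos hθ
    change a * s * _ < a * s' * _
    gcongr
  · change a * s * θ ^ (t' : ℝ) ≤ a * s * θ ^ (t : ℝ)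
    gcongr 1
    exact NNReal.rpow_le_rpow_of_exponent_ge hθ hθ1.le (by exact_mod_cast ht)
  · have h1 : Tendsto (fun t : ℝ≥0 => θ ^ (t : ℝ)) atTop (𝓝 0) := by
      rw [← NNReal.tendsto_coe]
      simp only [NNReal.coe_rpow, NNReal.coe_zero]
      exact (tendsto_rpow_atTop_of_base_lt_one (θ : ℝ) (by linarith [θ.coe_nonneg])
        (by exact_mod_cast hθ1)).comp (NNReal.tendsto_coe_atTop.2 tendsto_id)
    simpa using h1.const_mul (a * s)

lemma isClassK_mul_sq {a : ℝ≥0} (ha : 0 < a) : IsClassK fun s => a * s ^ 2 := by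
  refine ⟨by fun_prop, fun s s' hs => ?_, by simp⟩
  change a * s ^ 2 < a * s' ^ 2
  gcongr

/-! ### Iterating the one-step estimate. -/

namespace LQSystem

open Matrix

variable {n m₁ m₂ : ℕ} {S : LQSystem n m₁ m₂}

variable {K : Matrix (Fin m₁) (Fin n) ℝ} {L : Matrix (Fin m₂) (Fin n) ℝ}
  {P P' Pst : Matrix (Fin n) (Fin n) ℝ} {ρ : ℝ}

lemma IsLyapSolution.unique (hK : S.IsStableGain K L) (hP : S.IsLyapSolution K L P)
    (hP' : S.IsLyapSolution K L P') : P = P' := by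
  refine sub_eq_zero.1 (hK.eq_zero (hP.isSymm.sub hP'.isSymm) ?_)
  rw [← lyap_eq_genLyap, ← residual_sub, hP.residual_eq_zero, hP'.residual_eq_zero, sub_self]

lemma IsStableGain.exists_isLyapSolution (hK : S.IsStableGain K L) :
    ∃ P, S.IsLyapSolution K L P := by
  have hs : (-((S.Q - S.γ ^ 2 • (Lᵀ * L)) + Kᵀ * S.R * K)).IsSymm := by
    refine IsSymm.neg (IsSymm.add (IsSymm.sub ?_ (IsSymm.smul ?_ _)) ?_)
    · exact (posSemidef_real_iff.1 S.Q_posSemidef).1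
    · rw [IsSymm, transpose_mul, transpose_transpose]
    · exact (posSemidef_real_iff.1 (posSemidef_conj S.R_posDef.posSemidef K)).1
  obtain ⟨P, hP, h⟩ := hK.exists_eq hs
  refine ⟨P, hP, ?_⟩
  rw [lyap_eq_genLyap, h]
  abel

/-- The stable gains whose solutions of the Lyapunov-type equation lie in the sublevel set. -/
def IsGoodGain (S : LQSystem n m₁ m₂) (L : Matrix (Fin m₂) (Fin n) ℝ)
    (Pst : Matrix (Fin n) (Fin n) ℝ) (ρ : ℝ) (K : Matrix (Fin m₁) (Fin n) ℝ) : Prop :=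
  S.IsStableGain K L ∧ ∀ P, S.IsLyapSolution K L P → (P - Pst).trace ≤ ρ

lemma isGoodGain_of_mem_gainSublevel (hK : K ∈ S.gainSublevel L Pst ρ) :
    S.IsGoodGain L Pst ρ K := by
  obtain ⟨hadm, PK, hPK, htr⟩ := hK
  have hst := S.isStableGain_of_mem_admissibleGains hadm
  exact ⟨hst, fun P hP => by rwa [hP.unique hst hPK]⟩

-- Every good gain has a solution, and the step hypothesis keeps the recursion among good gains, so
-- the value 0 chosen for unsolvable gains is never met.
open Classical in
lemma exists_isInexactInnerLoop {K₀ : Matrix (Fin m₁) (Fin n) ℝ}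
    {δK : ℕ → Matrix (Fin m₁) (Fin n) ℝ} (h₀ : S.IsGoodGain L Pst ρ K₀)
    (hstep : ∀ j K P, S.IsGoodGain L Pst ρ K → S.IsLyapSolution K L P →
      S.IsGoodGain L Pst ρ (S.gainK P + δK (j + 1))) :
    ∃ Khat Pin, S.IsInexactInnerLoop L K₀ δK Khat Pin := by
  let sol : Matrix (Fin m₁) (Fin n) ℝ → Matrix (Fin n) (Fin n) ℝ := fun K =>
    if h : ∃ P, S.IsLyapSolution K L P then h.choose else 0
  have hsol : ∀ K, S.IsGoodGain L Pst ρ K → S.IsLyapSolution K L (sol K) := by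
    intro K hK
    have h := hK.1.exists_isLyapSolution
    simp only [sol, dif_pos h]
    exact h.choose_spec
  let Khat : ℕ → Matrix (Fin m₁) (Fin n) ℝ :=
    Nat.rec K₀ fun j K => S.gainK (sol K) + δK (j + 1)
  have hgood : ∀ j, S.IsGoodGain L Pst ρ (Khat j) := by
    intro j
    induction j with
    | zero => exact h₀
    | succ j ih => exact hstep j _ _ ih (hsol _ ih)
  refine ⟨Khat, fun j => sol (Khat (j - 1)), rfl, fun j => hsol _ (hgood j), fun j hj => ?_⟩
  obtain ⟨i, rfl⟩ := Nat.exists_eq_add_of_le' hj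
  rfl

/-- The inexact inner loop stays in the sublevel set, and the distance to the stabilizing
solution decays geometrically up to the square of the disturbance. -/
lemma IsInexactInnerLoop.trace_le {K₀ : Matrix (Fin m₁) (Fin n) ℝ}
    {δK Khat : ℕ → Matrix (Fin m₁) (Fin n) ℝ} {Pin : ℕ → Matrix (Fin n) (Fin n) ℝ}
    (hloop : S.IsInexactInnerLoop L K₀ δK Khat Pin) (h₀ : S.IsGoodGain L Pst ρ K₀)
    {θ d : ℝ} (hθ : 0 ≤ θ) (hθ1 : θ < 1) (hd : 0 ≤ d)
    (hstep : ∀ j K P, S.IsGoodGain L Pst ρ K → S.IsLyapSolution K L P →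
      S.IsGoodGain L Pst ρ (S.gainK P + δK (j + 1)) ∧
      ∀ P', S.IsLyapSolution (S.gainK P + δK (j + 1)) L P' →
        (P' - Pst).trace ≤ θ * (P - Pst).trace + d) (j : ℕ) :
    S.IsGoodGain L Pst ρ (Khat j) ∧
      (Pin (j + 1) - Pst).trace ≤ θ ^ j * (Pin 1 - Pst).trace + d / (1 - θ) := by
  induction j with
  | zero =>
    refine ⟨by rwa [hloop.init], ?_⟩
    have : 0 ≤ d / (1 - θ) := div_nonneg hd (by linarith)
    simpa using this
  | succ j ih =>
    have hs := hstep j (Khat j) (Pin (j + 1)) ih.1 (hloop.solve j)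
    have hsolve := hloop.solve (j + 1)
    rw [← hloop.update (j + 1) (by omega)] at hs
    refine ⟨hs.1, (hs.2 _ hsolve).trans ?_⟩
    have h1 := mul_le_mul_of_nonneg_left ih.2 hθ
    -- d/(1 - θ) is the fixed point of x ↦ θx + d.
    have h2 : θ * (d / (1 - θ)) + d = d / (1 - θ) := by
      field_simp [show (1 - θ) ≠ 0 by linarith]
      ring
    rw [pow_succ]
    linarith

end LQSystem

/-! ### Assembling the theorem. -/

lemma norm_le_toNNReal_supFrobenius {m n : ℕ} {δ : ℕ → Matrix (Fin m) (Fin n) ℝ}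
    (h : supFrobenius δ ≠ ⊤) (j : ℕ) : ‖δ (j + 1)‖ ≤ (supFrobenius δ).toNNReal := by
  have h1 : ‖δ (j + 1)‖ₑ ≤ supFrobenius δ := le_iSup (fun j : ℕ => ‖δ (j + 1)‖ₑ) j
  rw [← ENNReal.coe_toNNReal h, enorm_eq_nnnorm, ENNReal.coe_le_coe] at h1
  exact_mod_cast h1

theorem theorem6 {n m₁ m₂ : ℕ} (S : LQSystem n m₁ m₂)
    (δL Lhat : ℕ → Matrix (Fin m₂) (Fin n) ℝ) (Phat : ℕ → Matrix (Fin n) (Fin n) ℝ)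
    (hOuter : S.IsInexactOuterLoop δL Lhat Phat)
    (k : ℕ) (hk : 1 ≤ k) (ρ : ℝ) (hρ : 0 < ρ) :
    ∃ (ε : ℝ≥0) (ℓ : ℝ≥0 → ℝ≥0 → ℝ≥0) (κ : ℝ≥0 → ℝ≥0),
      0 < ε ∧ IsClassKL ℓ ∧ IsClassK κ ∧
      ∀ K₀ ∈ S.gainSublevel (Lhat (k - 1)) (Phat k) ρ,
      ∀ δK : ℕ → Matrix (Fin m₁) (Fin n) ℝ, supFrobenius δK < ε →
        (∃ (Khat : ℕ → Matrix (Fin m₁) (Fin n) ℝ) (Pin : ℕ → Matrix (Fin n) (Fin n) ℝ),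
          S.IsInexactInnerLoop (Lhat (k - 1)) K₀ δK Khat Pin) ∧
        ∀ (Khat : ℕ → Matrix (Fin m₁) (Fin n) ℝ) (Pin : ℕ → Matrix (Fin n) (Fin n) ℝ),
          S.IsInexactInnerLoop (Lhat (k - 1)) K₀ δK Khat Pin →
          ∀ j : ℕ, 1 ≤ j →
            ‖Pin j - Phat k‖₊ ≤
              ℓ ‖Pin 1 - Phat k‖₊ (j : ℝ≥0) + κ (supFrobenius δK).toNNReal := by
  obtain ⟨i, rfl⟩ := Nat.exists_eq_add_of_le' hk
  have hst := hOuter.solve i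
  rw [Nat.add_sub_cancel]
  generalize Lhat i = L at hst ⊢
  generalize Phat (i + 1) = Pst at hst ⊢
  obtain ⟨ε, θ, c, hε, hθ, hθ1, hc, hstep⟩ := LQSystem.exists_step_constants hst hρ
  lift θ to ℝ≥0 using hθ.le
  lift c to ℝ≥0 using hc.le
  have hθ' : 0 < θ := by exact_mod_cast hθ
  have hc' : 0 < c := by exact_mod_cast hc
  have hθ1' : θ < 1 := by exact_mod_cast hθ1
  have hgap : 0 < 1 - (θ : ℝ) := by linarith
  -- The last two bounds give cs² ≤ cs ≤ (1 - θ)ρ, so θρ + cs² ≤ ρ and the sublevel set is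
  -- invariant.
  set η : ℝ := min ε (min 1 ((1 - θ) * ρ / c)) with hη
  have hη0 : 0 < η := lt_min hε (lt_min one_pos (by positivity))
  -- The factor 1/θ offsets the index shift, since the j-th iterate has undergone j - 1
  -- contractions. Using n + 1 instead of n keeps the coefficient positive when n = 0.
  refine ⟨η.toNNReal, fun s t => ((n + 1) / θ) * s * θ ^ (t : ℝ), fun s => (c / (1 - θ)) * s ^ 2,
    Real.toNNReal_pos.2 hη0, isClassKL_mul_rpow (div_pos (by positivity) hθ') hθ' hθ1',
    isClassK_mul_sq (div_pos hc' (tsub_pos_of_lt hθ1')), fun K₀ hK₀ δK hδK => ?_⟩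
  have hfin : supFrobenius δK ≠ ⊤ := hδK.ne_top
  set s := (supFrobenius δK).toNNReal with hs
  have hsη : (s : ℝ) ≤ η := by
    rw [← ENNReal.coe_toNNReal hfin, ENNReal.coe_lt_coe] at hδK
    exact (NNReal.coe_le_coe.2 hδK.le).trans_eq (Real.coe_toNNReal η hη0.le)
  have hδ : ∀ j, ‖δK (j + 1)‖ ≤ s := norm_le_toNNReal_supFrobenius hfin
  have hs1 : (s : ℝ) ≤ 1 := hsη.trans ((min_le_right _ _).trans (min_le_left _ _))
  have hsc : c * (s : ℝ) ^ 2 ≤ (1 - θ) * ρ := by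
    have h1 : (s : ℝ) ≤ (1 - θ) * ρ / c := hsη.trans ((min_le_right _ _).trans (min_le_right _ _))
    rw [le_div_iff₀ hc] at h1
    nlinarith [mul_le_mul_of_nonneg_left hs1 (mul_nonneg c.coe_nonneg s.coe_nonneg)]
  have hgood := LQSystem.isGoodGain_of_mem_gainSublevel hK₀
  have hiter : ∀ j K P, S.IsGoodGain L Pst ρ K → S.IsLyapSolution K L P →
      S.IsGoodGain L Pst ρ (S.gainK P + δK (j + 1)) ∧
      ∀ P', S.IsLyapSolution (S.gainK P + δK (j + 1)) L P' →
        (P' - Pst).trace ≤ θ * (P - Pst).trace + c * (s : ℝ) ^ 2 := by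
    intro j K P hK hP
    have htr := hK.2 P hP
    obtain ⟨h1, h2⟩ := hstep K P (δK (j + 1)) hK.1 hP htr
      ((hδ j).trans (hsη.trans (min_le_left _ _)))
    have h3 : ∀ P', S.IsLyapSolution (S.gainK P + δK (j + 1)) L P' →
        (P' - Pst).trace ≤ θ * (P - Pst).trace + c * (s : ℝ) ^ 2 := by
      intro P' hP'
      refine (h2 P' hP').trans ?_
      gcongr
      exact hδ j
    refine ⟨⟨h1, fun P' hP' => (h3 P' hP').trans ?_⟩, h3⟩
    have h4 := mul_le_mul_of_nonneg_left htr hθ.le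
    linarith
  refine ⟨LQSystem.exists_isInexactInnerLoop hgood fun j K P hK hP => (hiter j K P hK hP).1,
    fun Khat Pin hloop j hj => ?_⟩
  obtain ⟨j, rfl⟩ := Nat.exists_eq_add_of_le' hj
  obtain ⟨hKj, htr⟩ := hloop.trace_le hgood hθ.le hθ1 (by positivity) hiter j
  have hX := hst.posSemidef_sub hKj.1 (hloop.solve j)
  have hbound : ‖Pin (j + 1) - Pst‖
      ≤ (θ : ℝ) ^ j * ((n + 1) * ‖Pin 1 - Pst‖) + c / (1 - θ) * (s : ℝ) ^ 2 := by
    refine hX.norm_le_trace.trans (htr.trans ?_)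
    rw [div_mul_eq_mul_div]
    gcongr
    exact (Matrix.trace_le_card_mul_norm _).trans (by gcongr; linarith)
  rw [← NNReal.coe_le_coe]
  push_cast [NNReal.coe_sub hθ1'.le]
  refine hbound.trans (le_of_eq ?_)
  rw [Real.rpow_add hθ, Real.rpow_one, Real.rpow_natCast]
  field_simp
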